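/- Let $d\ge 1$, $T\ge 0$ be integers, let $\mathcal X\subset\mathbb R^d$ be finite, and let $\{\mathbf p_v : v\in\{-1,1\}^d\}$ be a family of probability distributions on $\mathcal X$. For $v\in\{-1,1\}^d$ and $i\in[d]$ let $v^{\oplus i}$ be $v$ with the sign of its $i$th coordinate flipped. Assume that there are $\gamma\in\mathbb R$ and, for all $v$ and $i$, functions $\phi_{v,i}\colon\mathcal X\to\mathbb R$ such that $\mathbb E_{\mathbf p_v}[\phi_{v,i}\phi_{v,j}]=\mathbf 1\{i=j\}$ for all $v,i,j$, and, for all $v,i$, $\mathbf p_{v^{\oplus i}}$ is absolutely continuous with respect to $\mathbf p_v$ with $$\frac{d\mathbf p_{v^{\oplus i}}}{d\mathbf p_v}=1+\gamma\,\phi_{v,i}\qquad \mathbf p_v\text{-almost everywhere.}$$ An oblivious sampling channel on $\mathbb R^d$, specified by a probability vector $(w_i)_{i\in[d]}$, outputs $g(i)e_i$ with probability $w_i$ on input $g\in\mathbb R^d$ (the index $i$ is drawn from $w$ independently of $g$; $e_1,\dots,e_d$ is the standard basis). Let $V$ be uniform on $\{-1,1\}^d$ and, given $V=v$, let $X_1,\dots,X_T$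 be i.i.d. samples from $\mathbf p_v$. For $t=1,\dots,T$ let $Y_t$ be the output, on input $X_t$, of an oblivious sampling channel that is selected adaptively, i.e. as an arbitrary function of $Y_1,\dots,Y_{t-1}$. Write $Y^T=(Y_1,\dots,Y_T)$ and let $I(\cdot\wedge\cdot)$ be mutual information in nats. Then $$\sum_{i=1}^d I(V(i)\wedge Y^T)\le \frac C2\cdot T\gamma^2,$$ where, with $\mathcal X_i=\{x(i):x\in\mathcal X\}$, $$C=\Big(\max_{i\in[d]}|\mathcal X_i|-1\Big)\cdot\max_{x\in\mathcal X}\ \max_{v\in\{-1,1\}^d}\ \max_{i\in[d]}\ \frac{\mathbf p_{v^{\oplus i}}(X(i)=x(i))}{\mathbf p_v(X(i)=x(i))}$$ (ratios $0/0$ are disregarded in the maximum). -/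

import Mathlib

open MeasureTheory ProbabilityTheory InformationTheory
open scoped ENNReal

noncomputable section

/-- The hypercube `{-1, 1}^d`; the type `ℤˣ` has exactly the two elements `1` and `-1`. -/
abbrev Cube (d : ℕ) : Type := Fin d → ℤˣ

/-- `v^{⊕ i}`: the point `v` of the cube with the sign of its `i`-th coordinate flipped. -/
def flipAt {d : ℕ} (v : Cube d) (i : Fin d) : Cube d := Function.update v i (-v i)

/-- The orthonormal decomposition assumption with parameter `γ` for a family of distributions
`p v`, `v ∈ {-1, 1}^d`: there are functions `φ v i` which for every `v` are orthonormal in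
`L²(p v)`, and the Radon-Nikodym derivative of `p (v^{⊕ i})` with respect to `p v` exists and
equals `1 + γ φ v i`. -/
def OrthonormalDecomposition {d : ℕ} {Ω : Type*} [MeasurableSpace Ω]
    (p : Cube d → Measure Ω) (γ : ℝ) : Prop :=
  ∃ φ : Cube d → Fin d → Ω → ℝ, ∀ (v : Cube d) (i : Fin d),
    MemLp (φ v i) 2 (p v) ∧
    (∀ j : Fin d, ∫ x, φ v i x * φ v j x ∂(p v) = if i = j then 1 else 0) ∧
    p (flipAt v i) ≪ p v ∧
    ∀ᵐ x ∂(p v), ((p (flipAt v i)).rnDeriv (p v) x).toReal = 1 + γ * φ v i x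

/-- A channel with input alphabet `A` and output alphabet `B`, all of whose output distributions
are discrete: `W x` is the conditional distribution of the output given the input `x`. -/
abbrev DiscreteChannel (A B : Type*) := A → PMF B

/-- The oblivious sampling channel on `ℝ^d` with probability vector `w`: on input `g` it draws `i`
with distribution `w`, independently of `g`, and outputs `g(i) e_i`. -/
def obliviousSampling {d : ℕ} (w : PMF (Fin d)) : DiscreteChannel (Fin d → ℝ) (Fin d → ℝ) :=
  fun g => w.map fun i => Pi.single i (g i)

/-- The family of all oblivious sampling channels on `ℝ^d`. -/
def obliviousFamily (d : ℕ) : Set (DiscreteChannel (Fin d → ℝ) (Fin d → ℝ)) :=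
  Set.range obliviousSampling

/-- An adaptive channel selection strategy over `T` rounds: the channel used in a round is an
element of the family `𝒲` which is a function of the outputs of all earlier rounds. -/
abbrev AdaptiveStrategy {A B : Type*} (𝒲 : Set (DiscreteChannel A B)) (T : ℕ) :=
  (t : Fin T) → (Fin (t : ℕ) → B) → 𝒲

/-- The distribution of `Y^T = (Y_1, …, Y_T)` when the strategy `S` is used and the channel
inputs `X_1, …, X_T` are independent samples from `q`: in every round a fresh `x` is drawn from
`q` and passed through the channel that `S` selects on the basis of the earlier outputs. -/
def transcriptLaw {A B : Type*} {𝒲 : Set (DiscreteChannel A B)} (q : PMF A) :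
    (T : ℕ) → AdaptiveStrategy 𝒲 T → PMF (Fin T → B)
  | 0, _ => PMF.pure Fin.elim0
  | T + 1, S =>
      (transcriptLaw q T fun t => S t.castSucc).bind fun y =>
        q.bind fun x =>
          ((S (Fin.last T) y).1 x).map fun z => Fin.snoc (α := fun _ => B) y z

/-- The joint distribution of `(V, Y^T)`, where `V` is uniform on the cube and, given `V = v`, the
channel inputs are independent samples from `q v`. -/
def jointLaw {d : ℕ} {A B : Type*} {𝒲 : Set (DiscreteChannel A B)} {T : ℕ}
    (q : Cube d → PMF A) (S : AdaptiveStrategy 𝒲 T) : PMF (Cube d × (Fin T → B)) :=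
  (PMF.uniformOfFintype (Cube d)).bind fun v =>
    (transcriptLaw (q v) T S).map fun y => (v, y)

/-- The mutual information, in nats, of two random variables with joint distribution `ρ`. -/
def mutualInformation {α β : Type*} [MeasurableSpace α] [MeasurableSpace β]
    (ρ : Measure (α × β)) : ℝ≥0∞ :=
  klDiv ρ (ρ.fst.prod ρ.snd)

/-- `I(V(i) ∧ Y^T)`. -/
def coordinateInformation {d : ℕ} {A B : Type*} [MeasurableSpace B]
    {𝒲 : Set (DiscreteChannel A B)} {T : ℕ}
    (q : Cube d → PMF A) (S : AdaptiveStrategy 𝒲 T) (i : Fin d) : ℝ≥0∞ :=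
  mutualInformation ((jointLaw q S).map fun vy => (vy.1 i, vy.2)).toMeasure

/-- `𝒳_i = {x(i) : x ∈ 𝒳}`. -/
def coordinateValues {d : ℕ} (𝒳 : Finset (Fin d → ℝ)) (i : Fin d) : Finset ℝ :=
  𝒳.image fun x => x i

/-- The probability of the event `X(i) = z` for `X` with distribution `q`. -/
def coordinateProb {d : ℕ} {𝒳 : Finset (Fin d → ℝ)} (q : PMF 𝒳) (i : Fin d) (z : ℝ) : ℝ :=
  ((q.map fun x => x.1 i) z).toReal

/-- The constant `C`. The suprema are maxima over finite index sets. Under the orthonormal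
decomposition assumption numerator and denominator of a ratio vanish together; such a ratio has
the value `0` here, and hence does not contribute to the maximum. -/
def obliviousConstant {d : ℕ} {𝒳 : Finset (Fin d → ℝ)} (p : Cube d → PMF 𝒳) : ℝ :=
  (((Finset.univ.sup fun i : Fin d => (coordinateValues 𝒳 i).card : ℕ) : ℝ) - 1) *
    ⨆ x : 𝒳, ⨆ v : Cube d, ⨆ i : Fin d,
      coordinateProb (p (flipAt v i)) i (x.1 i) / coordinateProb (p v) i (x.1 i)

end

/-! Write `P v` for the transcript law given `V = v`. Data processing bounds `I(V(i) ∧ Y^T)` by the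
divergence of `P v` from the average of `P v` and `P (flipAt v i)`, averaged over `v`
(`mutualInformation_le`). Symmetrized over the flip, this is a Jensen-Shannon divergence.

It grows additively over rounds: by `log x ≤ x - 1`, one more round adds at most a quarter of the
two χ² divergences between the one-round output laws at `v` and at `flipAt v i`
(`jensenShannon_mul_le`, `sum_jensenShannon_transcriptLaw_le`). Only conditional output laws enter,
so adaptivity costs nothing.

For oblivious sampling, the sum over `i` of these χ² divergences is controlled by Bessel's
inequality: flipping `i` changes the probability of `X(j) = z` by `γ` times the inner product of its
indicator with `φ v i`, and the `φ v i` are orthonormal and, for `γ ≠ 0`, centred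
(`sum_chiSq_indexedSampling_le`). With `m = max |𝒳_i| - 1` this gives `m / 4 * T γ²`. The claim
follows because the largest likelihood ratio is at least one, so `m ≤ C` (`le_obliviousConstant`).
-/

/-! ### Scalar Jensen-Shannon inequalities. -/

/-- The summand `a log (2 a / (a + b))` of the relative entropy of `a` with respect to the
average of `a` and `b`. -/
noncomputable def midpointKL (a b : ℝ) : ℝ := a * Real.log (2 * a / (a + b))

/-- The (unnormalized) Jensen-Shannon summand. -/
noncomputable def jensenShannon (a b : ℝ) : ℝ := midpointKL a b + midpointKL b a

theorem midpointKL_mul_le {a b q r : ℝ} (ha : 0 ≤ a) (hb : 0 ≤ b) (hq : 0 < q) (hr : 0 < r) :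
    midpointKL (a * q) (b * r) ≤
      q * midpointKL a b + a * q * (q * (a + b) / (a * q + b * r) - 1) := by
  unfold midpointKL
  rcases ha.eq_or_lt with rfl | ha
  · simp
  have h1 : 0 < a * q + b * r := by positivity
  have h2 : 2 * (a * q) / (a * q + b * r) =
      (2 * a / (a + b)) * (q * (a + b) / (a * q + b * r)) := by
    have : a + b ≠ 0 := by positivity
    field_simp
  have h3 : 0 < q * (a + b) / (a * q + b * r) := by positivity
  rw [h2, Real.log_mul (by positivity) h3.ne']
  nlinarith [mul_le_mul_of_nonneg_left (Real.log_le_sub_one_of_pos h3) (mul_pos ha hq).le]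

theorem jensenShannon_mul_le {a b q r : ℝ} (ha : 0 ≤ a) (hb : 0 ≤ b) (hq : 0 ≤ q) (hr : 0 ≤ r)
    (hqr : q = 0 ↔ r = 0) :
    jensenShannon (a * q) (b * r) ≤ q * midpointKL a b + r * midpointKL b a +
      1 / 4 * (a * ((r - q) ^ 2 / q) + b * ((q - r) ^ 2 / r)) := by
  rcases hq.eq_or_lt with rfl | hq
  · obtain rfl := hqr.1 rfl
    simp [jensenShannon, midpointKL]
  have hr : 0 < r := hr.lt_of_ne fun h => hq.ne' (hqr.2 h.symm)
  have h1 := midpointKL_mul_le ha hb hq hr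
  have h2 := midpointKL_mul_le hb ha hr hq
  rw [add_comm b a, add_comm (b * r)] at h2
  suffices h : a * q * (q * (a + b) / (a * q + b * r) - 1) +
      b * r * (r * (a + b) / (a * q + b * r) - 1) ≤
      1 / 4 * (a * ((r - q) ^ 2 / q) + b * ((q - r) ^ 2 / r)) by
    unfold jensenShannon
    linarith
  by_cases h0 : a = 0 ∧ b = 0
  · simp [h0.1, h0.2]
  have hs : 0 < a * q + b * r := by
    rcases ha.eq_or_lt with rfl | ha
    · have : 0 < b := hb.lt_of_ne fun h => h0 ⟨rfl, h.symm⟩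
      positivity
    · positivity
  have e1 : a * q * (q * (a + b) / (a * q + b * r) - 1) +
      b * r * (r * (a + b) / (a * q + b * r) - 1) = a * b * (q - r) ^ 2 / (a * q + b * r) := by
    field_simp
    ring
  have e2 : 1 / 4 * (a * ((r - q) ^ 2 / q) + b * ((q - r) ^ 2 / r)) =
      (q - r) ^ 2 * (a * r + b * q) / (4 * (q * r)) := by
    field_simp
    ring
  rw [e1, e2, div_le_div_iff₀ hs (by positivity)]
  -- Right minus left is `q r (a - b)² + a b (q - r)²`.
  have h3 : a * b * (4 * (q * r)) ≤ (a * r + b * q) * (a * q + b * r) := by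
    nlinarith [mul_nonneg (mul_nonneg hq.le hr.le) (sq_nonneg (a - b)),
      mul_nonneg (mul_nonneg ha hb) (sq_nonneg (q - r))]
  nlinarith [mul_le_mul_of_nonneg_left h3 (sq_nonneg (q - r))]

/-! ### Discrete measures and their relative entropy. -/

theorem PMF.sum_toReal {α : Type*} [Fintype α] (q : PMF α) : ∑ x, (q x).toReal = 1 := by
  rw [← ENNReal.toReal_sum fun x _ => q.apply_ne_top x, ← tsum_fintype (L := .unconditional α),
    q.tsum_coe, ENNReal.toReal_one]

theorem PMF.prod_toMeasure {α β : Type*} [MeasurableSpace α] [MeasurableSpace β]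
    (a : PMF α) (b : PMF β) :
    a.toMeasure.prod b.toMeasure = (a.bind fun x => b.map (Prod.mk x)).toMeasure := by
  refine Measure.prod_eq fun s t hs ht => ?_
  rw [PMF.toMeasure_bind_apply _ _ _ (hs.prod ht), PMF.toMeasure_apply _ hs,
    ← ENNReal.tsum_mul_right]
  refine tsum_congr fun x => ?_
  rw [PMF.toMeasure_map_apply _ _ _ measurable_prodMk_left (hs.prod ht)]
  by_cases hx : x ∈ s
  · rw [Set.mk_preimage_prod_right hx, Set.indicator_of_mem hx]
  · rw [Set.mk_preimage_prod_right_eq_empty hx, Set.indicator_of_notMem hx]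
    simp

theorem PMF.toMeasure_absolutelyContinuous {α : Type*} [MeasurableSpace α] {p q : PMF α}
    (h : ∀ x, q x = 0 → p x = 0) : p.toMeasure ≪ q.toMeasure := by
  refine Measure.AbsolutelyContinuous.mk fun s hs h0 => ?_
  rw [PMF.toMeasure_apply_eq_zero_iff _ hs] at h0 ⊢
  exact h0.mono_left fun x hx hq => hx (h x hq)

theorem PMF.rnDeriv_mul_apply {α : Type*} [MeasurableSpace α] [MeasurableSingletonClass α]
    {p q : PMF α} (h : p.toMeasure ≪ q.toMeasure) (x : α) :
    p.toMeasure.rnDeriv q.toMeasure x * q x = p x := by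
  rw [← p.toMeasure_apply_singleton x (measurableSet_singleton x),
    ← q.toMeasure_apply_singleton x (measurableSet_singleton x)]
  conv_rhs => rw [← Measure.withDensity_rnDeriv_eq _ _ h]
  rw [withDensity_apply _ (measurableSet_singleton x), lintegral_singleton]

theorem PMF.klDiv_toMeasure_eq {α : Type*} [Fintype α] [MeasurableSpace α]
    [MeasurableSingletonClass α] {p q : PMF α} (h : ∀ x, q x = 0 → p x = 0) :
    klDiv p.toMeasure q.toMeasure =
      ENNReal.ofReal (∑ x, (p x).toReal * Real.log ((p x).toReal / (q x).toReal)) := by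
  have hac := PMF.toMeasure_absolutelyContinuous h
  rw [klDiv_of_ac_of_integrable hac Integrable.of_finite, PMF.integral_eq_sum]
  simp only [probReal_univ, add_sub_cancel_right]
  congr 1
  refine Finset.sum_congr rfl fun x _ => ?_
  rw [smul_eq_mul, llr]
  by_cases hp : p x = 0
  · simp [hp]
  have hq : q x ≠ 0 := fun h0 => hp (h x h0)
  congr 2
  rw [← PMF.rnDeriv_mul_apply hac x, ENNReal.toReal_mul, mul_div_cancel_right₀]
  exact (ENNReal.toReal_pos hq (q.apply_ne_top x)).ne'

theorem PMF.eq_of_ae {α : Type*} [MeasurableSpace α] [MeasurableSingletonClass α]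
    {p : PMF α} {P : α → Prop} (h : ∀ᵐ x ∂p.toMeasure, P x) {x : α} (hx : p x ≠ 0) : P x := by
  by_contra hP
  refine hx ?_
  rw [← p.toMeasure_apply_singleton x (measurableSet_singleton x)]
  exact measure_mono_null (by simpa using hP) h

/-! ### Coordinate flips and the bound on mutual information. -/

theorem flipAt_flipAt {d : ℕ} (v : Cube d) (i : Fin d) : flipAt (flipAt v i) i = v := by
  simp [flipAt]

theorem sum_flipAt {d : ℕ} {M : Type*} [AddCommMonoid M] (i : Fin d) (f : Cube d → M) :
    ∑ v, f (flipAt v i) = ∑ v, f v :=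
  Fintype.sum_equiv (Function.Involutive.toPerm (fun v => flipAt v i) fun v => flipAt_flipAt v i)
    _ _ fun _ => rfl

/-- Resampling coordinate `i` while remembering its old value leaves the old value independent of
the new uniform point, as `(v, ε) ↦ (v i, update v i ε)` is a bijection. -/
theorem uniform_bind_update {d : ℕ} {γ : Type*} (i : Fin d) (G : ℤˣ → Cube d → PMF γ) :
    ((PMF.uniformOfFintype (Cube d)).bind fun v => (PMF.uniformOfFintype ℤˣ).bind fun ε =>
      G (v i) (Function.update v i ε)) =
    (PMF.uniformOfFintype ℤˣ).bind fun δ => (PMF.uniformOfFintype (Cube d)).bind (G δ) := by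
  ext z
  simp only [PMF.bind_apply, tsum_fintype, PMF.uniformOfFintype_apply, ← Finset.mul_sum]
  rw [← mul_assoc, ← mul_assoc, mul_comm (_⁻¹ : ℝ≥0∞)]
  congr 1
  simp only [← Fintype.sum_prod_type']
  refine Fintype.sum_equiv ⟨fun x => (x.1 i, Function.update x.1 i x.2),
    fun x => (Function.update x.2 i x.1, x.2 i), fun x => ?_, fun x => ?_⟩ _ _ fun x => rfl
  · simp
  · simp

theorem uniform_map_apply {d : ℕ} (i : Fin d) :
    (PMF.uniformOfFintype (Cube d)).map (fun v => v i) = PMF.uniformOfFintype ℤˣ := by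
  simpa [PMF.map, Function.comp_def] using uniform_bind_update i fun δ _ => PMF.pure δ

theorem sum_units_update {d : ℕ} {M : Type*} [AddCommMonoid M] (v : Cube d) (i : Fin d)
    (f : Cube d → M) : ∑ ε : ℤˣ, f (Function.update v i ε) = f v + f (flipAt v i) := by
  have h : (Finset.univ : Finset ℤˣ) = {v i, -v i} := by
    rcases Int.units_eq_one_or (v i) with h | h <;> rw [h] <;> decide
  rw [h, Finset.sum_pair]
  · simp [flipAt]
  · rcases Int.units_eq_one_or (v i) with h | h <;> rw [h] <;> decide

theorem PMF.bind_map_mk_apply {α β : Type*} (p : PMF α) (P : α → PMF β) (a : α) (b : β) :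
    (p.bind fun a => (P a).map (Prod.mk a)) (a, b) = p a * P a b := by
  classical
  rw [PMF.bind_apply, tsum_eq_single a]
  · rw [PMF.map_apply, tsum_eq_single b]
    · simp
    · intro b' hb'
      simp [hb'.symm]
  · intro a' ha'
    simp [PMF.map_apply, ha'.symm]

theorem toReal_uniform_cube {d : ℕ} (v : Cube d) :
    (PMF.uniformOfFintype (Cube d) v).toReal = ((2 : ℝ) ^ d)⁻¹ := by
  simp [PMF.uniformOfFintype_apply]

/-- Under `τ` the transcript ignores coordinate `i` of `v`, so `h` maps `τ` to the product of the
marginals of the image of `σ`. Data processing along `h` then leaves the divergence of `σ` from `τ`.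
-/
theorem mutualInformation_le {d : ℕ} {Y β : Type*} [Fintype Y] [MeasurableSpace β]
    (P : Cube d → PMF Y) (F : Y → β) (i : Fin d) :
    mutualInformation ((((PMF.uniformOfFintype (Cube d)).bind fun v =>
      (P v).map (Prod.mk v)).map fun vy => (vy.1 i, F vy.2))).toMeasure ≤
    ENNReal.ofReal (((2 : ℝ) ^ d)⁻¹ / 2 *
      ∑ v, ∑ y, jensenShannon (P v y).toReal (P (flipAt v i) y).toReal) := by
  set U := PMF.uniformOfFintype (Cube d)
  set σ : PMF (Cube d × Y) := U.bind fun v => (P v).map (Prod.mk v) with hσ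
  set τ : PMF (Cube d × Y) := U.bind fun v =>
    ((PMF.uniformOfFintype ℤˣ).bind fun ε => P (Function.update v i ε)).map (Prod.mk v) with hτ
  set h : Cube d × Y → ℤˣ × β := fun vy => (vy.1 i, F vy.2)
  -- The discrete σ-algebra makes `h` measurable whatever the σ-algebra on `β`.
  let _ : MeasurableSpace (Cube d × Y) := ⊤
  have hm : Measurable h := measurable_from_top
  have h1 : (σ.map h).toMeasure.fst = (PMF.uniformOfFintype ℤˣ).toMeasure := by
    rw [Measure.fst, PMF.toMeasure_map _ _ measurable_fst, PMF.map_comp, hσ, PMF.map_bind,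
      ← uniform_map_apply i, PMF.map]
    simp only [PMF.map_comp]
    congr 1
    refine congrArg _ (funext fun v => ?_)
    exact PMF.map_const _ _
  have h2 : (σ.map h).toMeasure.snd = (U.bind fun v => (P v).map F).toMeasure := by
    rw [Measure.snd, PMF.toMeasure_map _ _ measurable_snd, PMF.map_comp, hσ, PMF.map_bind]
    simp only [PMF.map_comp]
    rfl
  have h3 : τ.map h = (PMF.uniformOfFintype ℤˣ).bind fun δ =>
      (U.bind fun v => (P v).map F).map (Prod.mk δ) := by
    simp only [hτ, PMF.map_bind, PMF.map_comp]
    exact uniform_bind_update i fun δ v => (P v).map (Prod.mk δ ∘ F)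
  have hσa (v : Cube d) (y : Y) : (σ (v, y)).toReal = ((2 : ℝ) ^ d)⁻¹ * (P v y).toReal := by
    rw [hσ, PMF.bind_map_mk_apply, ENNReal.toReal_mul, toReal_uniform_cube]
  have hτe (v : Cube d) (y : Y) :
      τ (v, y) = U v * (2⁻¹ * (P v y + P (flipAt v i) y)) := by
    rw [hτ, PMF.bind_map_mk_apply, PMF.bind_apply, tsum_fintype]
    simp only [PMF.uniformOfFintype_apply, ← Finset.mul_sum]
    rw [sum_units_update v i fun v => P v y]
    simp
  have hτa (v : Cube d) (y : Y) : (τ (v, y)).toReal =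
      ((2 : ℝ) ^ d)⁻¹ * (2⁻¹ * ((P v y).toReal + (P (flipAt v i) y).toReal)) := by
    rw [hτe, ENNReal.toReal_mul, toReal_uniform_cube, ENNReal.toReal_mul,
      ENNReal.toReal_add (PMF.apply_ne_top _ _) (PMF.apply_ne_top _ _)]
    simp
  have hac : ∀ x, τ x = 0 → σ x = 0 := by
    rintro ⟨v, y⟩ h0
    rw [hσ, PMF.bind_map_mk_apply]
    rw [hτe, mul_eq_zero, mul_eq_zero] at h0
    rcases h0 with h0 | h0 | h0
    · rw [h0, zero_mul]
    · simp at h0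
    · rw [(add_eq_zero.1 h0).1, mul_zero]
  rw [mutualInformation, h1, h2, PMF.prod_toMeasure, ← h3, ← PMF.toMeasure_map _ _ hm,
    ← PMF.toMeasure_map _ _ hm]
  refine (klDiv_map_le _ _ hm).trans ?_
  rw [PMF.klDiv_toMeasure_eq hac]
  refine ENNReal.ofReal_le_ofReal (le_of_eq ?_)
  have hK (v : Cube d) (y : Y) : (σ (v, y)).toReal *
      Real.log ((σ (v, y)).toReal / (τ (v, y)).toReal) =
      ((2 : ℝ) ^ d)⁻¹ * midpointKL (P v y).toReal (P (flipAt v i) y).toReal := by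
    rw [hσa, hτa, midpointKL, mul_div_mul_left _ _ (by positivity), mul_assoc]
    congr 3
    rw [div_mul_eq_div_div, div_inv_eq_mul, mul_comm 2]
  rw [Fintype.sum_prod_type]
  simp only [hK, ← Finset.mul_sum, jensenShannon, Finset.sum_add_distrib]
  -- Reindexing by the flip swaps the two arguments of `midpointKL`; this gives the factor `1 / 2`.
  have hs := sum_flipAt i fun v =>
    ∑ y, midpointKL (P v y).toReal (P (flipAt v i) y).toReal
  simp only [flipAt_flipAt] at hs
  rw [hs]
  ring

/-! ### Transcripts and additivity over rounds. -/

theorem transcriptLaw_snoc {A B : Type*} {𝒲 : Set (DiscreteChannel A B)} (q : PMF A) {T : ℕ}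
    (S : AdaptiveStrategy 𝒲 (T + 1)) (y : Fin T → B) (z : B) :
    transcriptLaw q (T + 1) S (Fin.snoc (α := fun _ => B) y z) =
      transcriptLaw q T (fun t => S t.castSucc) y * q.bind (S (Fin.last T) y).1 z := by
  classical
  simp only [transcriptLaw, ← PMF.map_bind]
  rw [PMF.bind_apply, tsum_eq_single y]
  · rw [PMF.map_apply, tsum_eq_single z]
    · rw [if_pos rfl]
    · intro z' hz'
      rw [if_neg fun h => hz' (Fin.snoc_injective2 h).2.symm]
  · intro y' hy'
    rw [PMF.map_apply]
    simp [fun z' => show ¬ (Fin.snoc (α := fun _ => B) y z : Fin (T + 1) → B) =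
      Fin.snoc (α := fun _ => B) y' z' from fun h => hy' (Fin.snoc_injective2 h).1.symm]

theorem transcriptLaw_map {A A' B B' : Type*} {𝒲 : Set (DiscreteChannel A B)}
    {𝒲' : Set (DiscreteChannel A' B')} (g : A' → A) (f : B' → B) (q : PMF A') {T : ℕ}
    (S : AdaptiveStrategy 𝒲 T) (S' : AdaptiveStrategy 𝒲' T)
    (h : ∀ t y x, (S t (f ∘ y)).1 (g x) = ((S' t y).1 x).map f) :
    transcriptLaw (q.map g) T S = (transcriptLaw q T S').map fun y => f ∘ y := by
  induction T with
  | zero =>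
    simp only [transcriptLaw, PMF.pure_map]
    congr 1
    exact Subsingleton.elim _ _
  | succ T ih =>
    simp only [transcriptLaw]
    rw [ih _ (fun t => S' t.castSucc) fun t => h t.castSucc]
    simp only [PMF.map_bind, PMF.bind_map, PMF.map_comp]
    refine congrArg _ (funext fun y => ?_)
    simp only [Function.comp_apply]
    refine congrArg _ (funext fun x => ?_)
    simp only [Function.comp_apply]
    rw [h (Fin.last T) y x, PMF.map_comp]
    refine congrArg (fun k => PMF.map k _) (funext fun z => ?_)
    exact (Fin.comp_snoc f y z).symm

/-- From `log x ≥ 1 - 1 / x`; the linear lower bounds cancel on symmetrizing. -/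
theorem sub_div_two_le_midpointKL {a b : ℝ} (ha : 0 ≤ a) (hb : 0 ≤ b) :
    (a - b) / 2 ≤ midpointKL a b := by
  unfold midpointKL
  rcases ha.eq_or_lt with rfl | ha
  · rw [zero_mul]
    linarith
  have h : 0 < 2 * a / (a + b) := by positivity
  have h1 := mul_le_mul_of_nonneg_left (Real.one_sub_inv_le_log_of_pos h) ha.le
  have h2 : a * (1 - (2 * a / (a + b))⁻¹) = (a - b) / 2 := by
    field_simp
    ring
  linarith

theorem jensenShannon_nonneg {a b : ℝ} (ha : 0 ≤ a) (hb : 0 ≤ b) : 0 ≤ jensenShannon a b := by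
  have h1 := sub_div_two_le_midpointKL ha hb
  have h2 := sub_div_two_le_midpointKL hb ha
  unfold jensenShannon
  linarith

/-- The chi-square divergence of `r` from `q`. -/
noncomputable def chiSq {B : Type*} [Fintype B] (r q : PMF B) : ℝ :=
  ∑ z, ((r z).toReal - (q z).toReal) ^ 2 / (q z).toReal

theorem sum_jensenShannon_mul_le {B : Type*} [Fintype B] {a b : ℝ} (ha : 0 ≤ a) (hb : 0 ≤ b)
    (q r : PMF B) (h : ∀ z, q z = 0 ↔ r z = 0) :
    ∑ z, jensenShannon (a * (q z).toReal) (b * (r z).toReal) ≤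
      jensenShannon a b + 1 / 4 * (a * chiSq r q + b * chiSq q r) := by
  refine (Finset.sum_le_sum fun z _ => jensenShannon_mul_le ha hb ENNReal.toReal_nonneg
    ENNReal.toReal_nonneg ?_).trans (le_of_eq ?_)
  · simp [ENNReal.toReal_eq_zero_iff, PMF.apply_ne_top, h z]
  · simp only [Finset.sum_add_distrib, ← Finset.sum_mul, ← Finset.mul_sum, PMF.sum_toReal,
      jensenShannon, chiSq, one_mul]

theorem sum_jensenShannon_transcriptLaw_le {d : ℕ} {A B : Type*} [Fintype B]
    {𝒲 : Set (DiscreteChannel A B)} (q : Cube d → PMF A) {M : ℝ}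
    (hac : ∀ W ∈ 𝒲, ∀ v i z, (q v).bind W z = 0 → (q (flipAt v i)).bind W z = 0)
    (hM : ∀ W ∈ 𝒲, ∀ v, ∑ i, chiSq ((q (flipAt v i)).bind W) ((q v).bind W) ≤ M)
    {T : ℕ} (S : AdaptiveStrategy 𝒲 T) :
    ∑ i, ∑ v, ∑ y, jensenShannon (transcriptLaw (q v) T S y).toReal
      (transcriptLaw (q (flipAt v i)) T S y).toReal ≤ T * (2 ^ d * M / 2) := by
  induction T with
  | zero =>
    have h (y : Fin 0 → B) (v : Cube d) : transcriptLaw (q v) 0 S y = 1 := by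
      rw [Subsingleton.elim y Fin.elim0]
      exact PMF.pure_apply_self _
    simp [h, jensenShannon, midpointKL, one_add_one_eq_two]
  | succ T ih =>
    set S' : AdaptiveStrategy 𝒲 T := fun t => S t.castSucc with hS'
    set P : Cube d → PMF (Fin T → B) := fun v => transcriptLaw (q v) T S' with hP
    set Q : Cube d → (Fin T → B) → PMF B := fun v y => (q v).bind (S (Fin.last T) y).1 with hQ
    have hstep (i : Fin d) (v : Cube d) :
        ∑ y, jensenShannon (transcriptLaw (q v) (T + 1) S y).toReal
          (transcriptLaw (q (flipAt v i)) (T + 1) S y).toReal ≤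
        ∑ y, (jensenShannon (P v y).toReal (P (flipAt v i) y).toReal +
          1 / 4 * ((P v y).toReal * chiSq (Q (flipAt v i) y) (Q v y) +
            (P (flipAt v i) y).toReal * chiSq (Q v y) (Q (flipAt v i) y))) := by
      rw [← (Fin.snocEquiv fun _ => B).sum_comp, Fintype.sum_prod_type_right]
      refine Finset.sum_le_sum fun y _ => ?_
      have hs (v : Cube d) (z : B) : (transcriptLaw (q v) (T + 1) S
          (Fin.snocEquiv (fun _ => B) (z, y))).toReal = (P v y).toReal * (Q v y z).toReal := by
        rw [← ENNReal.toReal_mul]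
        exact congrArg _ (transcriptLaw_snoc (q v) S y z)
      simp only [hs]
      refine sum_jensenShannon_mul_le ENNReal.toReal_nonneg ENNReal.toReal_nonneg _ _ fun z => ?_
      refine ⟨hac _ (S (Fin.last T) y).2 v i z, fun h => ?_⟩
      have := hac _ (S (Fin.last T) y).2 (flipAt v i) i z h
      rwa [flipAt_flipAt] at this
    -- Summed over `v`, both χ² terms agree, so `1 / 4` becomes `1 / 2`.
    have hflip (i : Fin d) : ∑ v, ∑ y,
        (P (flipAt v i) y).toReal * chiSq (Q v y) (Q (flipAt v i) y) =
        ∑ v, ∑ y, (P v y).toReal * chiSq (Q (flipAt v i) y) (Q v y) := by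
      have := sum_flipAt i fun v =>
        ∑ y, (P v y).toReal * chiSq (Q (flipAt v i) y) (Q v y)
      simpa only [flipAt_flipAt] using this
    have hchi : ∑ i, ∑ v, ∑ y, (P v y).toReal * chiSq (Q (flipAt v i) y) (Q v y) ≤ 2 ^ d * M := by
      calc _ = ∑ v, ∑ y, (P v y).toReal * ∑ i, chiSq (Q (flipAt v i) y) (Q v y) := by
            rw [Finset.sum_comm]
            refine Finset.sum_congr rfl fun v _ => ?_
            rw [Finset.sum_comm]
            simp only [Finset.mul_sum]
        _ ≤ ∑ v : Cube d, ∑ y, (P v y).toReal * M := by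
            gcongr with v _ y _
            exact hM _ (S (Fin.last T) y).2 v
        _ = 2 ^ d * M := by
            simp [← Finset.sum_mul, PMF.sum_toReal]
    have ih' := ih S'
    calc _ ≤ _ := Finset.sum_le_sum fun i _ => Finset.sum_le_sum fun v _ => hstep i v
      _ = (∑ i, ∑ v, ∑ y, jensenShannon (P v y).toReal (P (flipAt v i) y).toReal) +
          1 / 2 * ∑ i, ∑ v, ∑ y, (P v y).toReal * chiSq (Q (flipAt v i) y) (Q v y) := by
        simp only [Finset.sum_add_distrib, ← Finset.mul_sum, hflip]
        ring
      _ ≤ _ := by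
        push_cast
        linarith

/-! ### Bessel's inequality and the χ² bound for oblivious sampling. -/

/-- Expand the squared norm of `f` minus its mean minus its projection on the `φ i`. Centring makes
the `φ i` orthogonal to constants, which yields the variance rather than the second moment. -/
theorem sum_sq_inner_le_variance {X ι : Type*} [Fintype X] [Fintype ι] [DecidableEq ι]
    {p : X → ℝ} (hp : ∀ x, 0 ≤ p x) (hp1 : ∑ x, p x = 1) (φ : ι → X → ℝ)
    (horth : ∀ i j, ∑ x, p x * (φ i x * φ j x) = if i = j then 1 else 0)
    (hmean : ∀ i, ∑ x, p x * φ i x = 0) (f : X → ℝ) :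
    ∑ i, (∑ x, p x * (φ i x * f x)) ^ 2 ≤ ∑ x, p x * f x ^ 2 - (∑ x, p x * f x) ^ 2 := by
  set c : ι → ℝ := fun i => ∑ x, p x * (φ i x * f x) with hc
  set m := ∑ x, p x * f x with hm
  set g : X → ℝ := fun x => ∑ i, c i * φ i x with hg
  have key (k : X → ℝ) : ∑ x, p x * (g x * k x) = ∑ i, c i * ∑ x, p x * (φ i x * k x) := by
    simp only [hg, Finset.sum_mul, Finset.mul_sum]
    rw [Finset.sum_comm]
    exact Finset.sum_congr rfl fun i _ => Finset.sum_congr rfl fun x _ => by ring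
  have g1 : ∑ x, p x * g x = 0 := by simpa [hmean] using key fun _ => 1
  have gf : ∑ x, p x * (g x * f x) = ∑ i, c i ^ 2 := by
    rw [key]
    exact Finset.sum_congr rfl fun i _ => by rw [sq]
  have gg : ∑ x, p x * (g x * g x) = ∑ i, c i ^ 2 := by
    rw [key]
    refine Finset.sum_congr rfl fun i _ => ?_
    have := key (φ i)
    simp only [horth, mul_ite, mul_one, mul_zero, Finset.sum_ite_eq', Finset.mem_univ,
      if_true] at this
    rw [sq, ← this]
    simp only [mul_comm (g _)]
  have h0 : 0 ≤ ∑ x, p x * (f x - m - g x) ^ 2 :=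
    Finset.sum_nonneg fun x _ => mul_nonneg (hp x) (sq_nonneg _)
  have h1 : ∑ x, p x * (f x - m - g x) ^ 2 = ∑ x, p x * f x ^ 2 + m ^ 2 * ∑ x, p x +
      ∑ x, p x * (g x * g x) - 2 * m * ∑ x, p x * f x - 2 * ∑ x, p x * (g x * f x) +
      2 * m * ∑ x, p x * g x := by
    simp only [Finset.mul_sum, ← Finset.sum_add_distrib, ← Finset.sum_sub_distrib]
    exact Finset.sum_congr rfl fun x _ => by ring
  rw [h1, gg, gf, g1, hp1, ← hm] at h0
  linarith

/-- The oblivious sampling channel with the sampled index made part of the output. -/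
noncomputable def indexedSampling {d : ℕ} {𝒳 : Finset (Fin d → ℝ)} (w : PMF (Fin d)) :
    DiscreteChannel 𝒳 (Σ i : Fin d, coordinateValues 𝒳 i) :=
  fun x => w.map fun i => ⟨i, x.1 i, Finset.mem_image_of_mem _ x.2⟩

theorem coordinateProb_eq {d : ℕ} {𝒳 : Finset (Fin d → ℝ)} (q : PMF 𝒳) (i : Fin d) (z : ℝ) :
    coordinateProb q i z = ∑ x, (q x).toReal * if x.1 i = z then 1 else 0 := by
  classical
  rw [coordinateProb, PMF.map_apply, tsum_fintype, ENNReal.toReal_sum]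
  · refine Finset.sum_congr rfl fun x _ => ?_
    by_cases h : x.1 i = z
    · simp [h]
    · simp [h, Ne.symm h]
  · intro x _
    split_ifs
    · exact q.apply_ne_top x
    · simp

theorem coordinateProb_nonneg {d : ℕ} {𝒳 : Finset (Fin d → ℝ)} (q : PMF 𝒳) (i : Fin d) (z : ℝ) :
    0 ≤ coordinateProb q i z := ENNReal.toReal_nonneg

theorem sum_coordinateProb {d : ℕ} {𝒳 : Finset (Fin d → ℝ)} (q : PMF 𝒳) (i : Fin d) :
    ∑ z ∈ coordinateValues 𝒳 i, coordinateProb q i z = 1 := by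
  simp only [coordinateProb_eq]
  rw [Finset.sum_comm]
  refine Eq.trans (Finset.sum_congr rfl fun x _ => ?_) q.sum_toReal
  have hx : x.1 i ∈ coordinateValues 𝒳 i := Finset.mem_image_of_mem (fun x => x i) x.2
  rw [← Finset.mul_sum, Finset.sum_ite_eq, if_pos hx, mul_one]

theorem coordinateProb_le_one {d : ℕ} {𝒳 : Finset (Fin d → ℝ)} (q : PMF 𝒳) (i : Fin d) (z : ℝ) :
    coordinateProb q i z ≤ 1 :=
  ENNReal.toReal_le_of_le_ofReal zero_le_one (by rw [ENNReal.ofReal_one]; exact PMF.coe_le_one _ _)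

theorem bind_indexedSampling_toReal {d : ℕ} {𝒳 : Finset (Fin d → ℝ)} (q : PMF 𝒳)
    (w : PMF (Fin d)) (j : Fin d) (z : coordinateValues 𝒳 j) :
    (q.bind (indexedSampling w) ⟨j, z⟩).toReal = (w j).toReal * coordinateProb q j z := by
  classical
  have h (x : 𝒳) : indexedSampling w x ⟨j, z⟩ = w j * if x.1 j = z then 1 else 0 := by
    rw [indexedSampling, PMF.map_apply, tsum_eq_single j]
    · have : ((⟨j, z⟩ : Σ i : Fin d, coordinateValues 𝒳 i) =
          ⟨j, x.1 j, Finset.mem_image_of_mem _ x.2⟩) ↔ x.1 j = z := by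
        simp [Subtype.ext_iff, eq_comm]
      simp only [this, mul_ite, mul_one, mul_zero]
    · intro i hi
      rw [if_neg fun h => hi (congrArg Sigma.fst h).symm]
  rw [PMF.bind_apply, tsum_fintype, ENNReal.toReal_sum
    fun x _ => ENNReal.mul_ne_top (PMF.apply_ne_top _ _) (PMF.apply_ne_top _ _),
    coordinateProb_eq, Finset.mul_sum]
  refine Finset.sum_congr rfl fun x _ => ?_
  rw [h, ENNReal.toReal_mul, ENNReal.toReal_mul, mul_left_comm]
  split_ifs <;> simp

theorem OrthonormalDecomposition.exists_pmf {d : ℕ} {Ω : Type*} [Fintype Ω] [MeasurableSpace Ω]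
    [MeasurableSingletonClass Ω] {p : Cube d → PMF Ω} {γ : ℝ}
    (hp : OrthonormalDecomposition (fun v => (p v).toMeasure) γ) :
    ∃ φ : Cube d → Fin d → Ω → ℝ,
      (∀ v i j, ∑ x, (p v x).toReal * (φ v i x * φ v j x) = if i = j then 1 else 0) ∧
      ∀ v i x, (p (flipAt v i) x).toReal = (p v x).toReal * (1 + γ * φ v i x) := by
  obtain ⟨φ, hφ⟩ := hp
  refine ⟨φ, fun v i j => ?_, fun v i x => ?_⟩
  · rw [← (hφ v i).2.1 j, PMF.integral_eq_sum]
    rfl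
  · obtain ⟨-, -, hac, hd⟩ := hφ v i
    rw [← PMF.rnDeriv_mul_apply hac x, ENNReal.toReal_mul, mul_comm]
    by_cases h0 : p v x = 0
    · simp [h0]
    · rw [PMF.eq_of_ae hd h0]

theorem sum_chiSq_indexedSampling_le {d : ℕ} {𝒳 : Finset (Fin d → ℝ)} {p : Cube d → PMF 𝒳} {γ : ℝ}
    {φ : Cube d → Fin d → 𝒳 → ℝ}
    (horth : ∀ v i j, ∑ x, (p v x).toReal * (φ v i x * φ v j x) = if i = j then 1 else 0)
    (hflip : ∀ v i x, (p (flipAt v i) x).toReal = (p v x).toReal * (1 + γ * φ v i x))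
    (w : PMF (Fin d)) (v : Cube d) :
    ∑ i, chiSq ((p (flipAt v i)).bind (indexedSampling w)) ((p v).bind (indexedSampling w)) ≤
      γ ^ 2 * (((Finset.univ.sup fun i : Fin d => (coordinateValues 𝒳 i).card : ℕ) : ℝ) - 1) := by
  -- Both laws have total mass one.
  have hmean (i : Fin d) : γ * ∑ x, (p v x).toReal * φ v i x = 0 := by
    have h := (p (flipAt v i)).sum_toReal
    simp only [hflip, mul_add, mul_one, Finset.sum_add_distrib, PMF.sum_toReal] at h
    rw [Finset.mul_sum]
    simp only [mul_left_comm γ]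
    linarith
  have hdiff (i j : Fin d) (z : ℝ) :
      coordinateProb (p (flipAt v i)) j z - coordinateProb (p v) j z =
      γ * ∑ x, (p v x).toReal * (φ v i x * if x.1 j = z then 1 else 0) := by
    simp only [coordinateProb_eq, hflip, ← Finset.sum_sub_distrib, Finset.mul_sum]
    exact Finset.sum_congr rfl fun x _ => by ring
  have hbessel (j : Fin d) (z : ℝ) :
      ∑ i, (coordinateProb (p (flipAt v i)) j z - coordinateProb (p v) j z) ^ 2 ≤
      γ ^ 2 * (coordinateProb (p v) j z * (1 - coordinateProb (p v) j z)) := by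
    simp only [hdiff, mul_pow, ← Finset.mul_sum]
    rcases eq_or_ne γ 0 with rfl | hγ
    · simp
    refine mul_le_mul_of_nonneg_left ?_ (sq_nonneg γ)
    refine (sum_sq_inner_le_variance (fun x => ENNReal.toReal_nonneg) (p v).sum_toReal (φ v)
      (horth v) (fun i => (mul_eq_zero.1 (hmean i)).resolve_left hγ) _).trans (le_of_eq ?_)
    simp only [ite_pow, one_pow, zero_pow two_ne_zero, ← coordinateProb_eq]
    ring
  have hterm (j : Fin d) (z : ℝ) : ∑ i,
      ((w j).toReal * coordinateProb (p (flipAt v i)) j z -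
        (w j).toReal * coordinateProb (p v) j z) ^ 2 / ((w j).toReal * coordinateProb (p v) j z) ≤
      (w j).toReal * γ ^ 2 * (1 - coordinateProb (p v) j z) := by
    have hw : 0 ≤ (w j).toReal := ENNReal.toReal_nonneg
    have he := coordinateProb_nonneg (p v) j z
    have he1 := sub_nonneg.2 (coordinateProb_le_one (p v) j z)
    simp only [← mul_sub, mul_pow]
    rw [← Finset.sum_div, ← Finset.mul_sum]
    -- Also covers a zero denominator, where the quotient is `0`.
    refine div_le_of_le_mul₀ (by positivity) (by positivity) ?_
    calc _ ≤ _ := mul_le_mul_of_nonneg_left (hbessel j z) (sq_nonneg _)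
      _ = _ := by ring
  simp only [chiSq]
  rw [Finset.sum_comm, Fintype.sum_sigma]
  simp only [bind_indexedSampling_toReal]
  calc _ ≤ ∑ j, ∑ z : coordinateValues 𝒳 j,
        (w j).toReal * γ ^ 2 * (1 - coordinateProb (p v) j z) :=
      Finset.sum_le_sum fun j _ => Finset.sum_le_sum fun z _ => hterm j z
    _ = ∑ j, (w j).toReal * (γ ^ 2 * (((coordinateValues 𝒳 j).card : ℝ) - 1)) := by
      refine Finset.sum_congr rfl fun j _ => ?_
      rw [← Finset.mul_sum, Finset.sum_sub_distrib,
        Finset.sum_coe_sort (coordinateValues 𝒳 j) fun z => coordinateProb (p v) j z,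
        sum_coordinateProb, mul_assoc]
      simp
    _ ≤ ∑ j, (w j).toReal * (γ ^ 2 *
        (((Finset.univ.sup fun i : Fin d => (coordinateValues 𝒳 i).card : ℕ) : ℝ) - 1)) := by
      gcongr with j _
      exact Finset.le_sup (f := fun i : Fin d => (coordinateValues 𝒳 i).card) (Finset.mem_univ j)
    _ = _ := by rw [← Finset.sum_mul, PMF.sum_toReal, one_mul]

/-! ### Comparison with the constant `C`. -/

theorem one_le_sup_card_coordinateValues {d : ℕ} {𝒳 : Finset (Fin d → ℝ)} (q : PMF 𝒳)
    (i : Fin d) :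
    (1 : ℝ) ≤ (Finset.univ.sup fun i : Fin d => (coordinateValues 𝒳 i).card : ℕ) := by
  obtain ⟨x, -⟩ := q.support_nonempty
  have h : 1 ≤ (coordinateValues 𝒳 i).card :=
    Finset.card_pos.2 ⟨_, Finset.mem_image_of_mem _ x.2⟩
  exact_mod_cast h.trans
    (Finset.le_sup (f := fun i : Fin d => (coordinateValues 𝒳 i).card) (Finset.mem_univ i))

theorem le_obliviousConstant {d : ℕ} {𝒳 : Finset (Fin d → ℝ)} {p : Cube d → PMF 𝒳} (i : Fin d)
    (h0 : ∀ v x, p v x = 0 → p (flipAt v i) x = 0) :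
    ((Finset.univ.sup fun i : Fin d => (coordinateValues 𝒳 i).card : ℕ) : ℝ) - 1 ≤
      obliviousConstant p := by
  have v : Cube d := 1
  refine le_mul_of_one_le_right (sub_nonneg.2 (one_le_sup_card_coordinateValues (p v) i)) ?_
  -- If every ratio were below one, the law of `X(i)` under `flipAt v i` would have mass below one.
  by_contra! hlt
  have hx (x : 𝒳) : coordinateProb (p (flipAt v i)) i (x.1 i) / coordinateProb (p v) i (x.1 i) < 1 :=
    ((le_ciSup (f := fun i : Fin d => coordinateProb (p (flipAt v i)) i (x.1 i) /
        coordinateProb (p v) i (x.1 i)) (Finite.bddAbove_range _) i).trans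
      ((le_ciSup (f := fun v : Cube d => ⨆ i : Fin d, coordinateProb (p (flipAt v i)) i (x.1 i) /
        coordinateProb (p v) i (x.1 i)) (Finite.bddAbove_range _) v).trans
      (le_ciSup (f := fun x : 𝒳 => ⨆ v : Cube d, ⨆ i : Fin d,
        coordinateProb (p (flipAt v i)) i (x.1 i) / coordinateProb (p v) i (x.1 i))
        (Finite.bddAbove_range _) x))).trans_lt hlt
  have hzero (z : ℝ) (h : coordinateProb (p v) i z = 0) :
      coordinateProb (p (flipAt v i)) i z = 0 := by
    rw [coordinateProb_eq] at h ⊢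
    rw [Finset.sum_eq_zero_iff_of_nonneg fun x _ => by positivity] at h
    refine Finset.sum_eq_zero fun x hx => ?_
    rcases mul_eq_zero.1 (h x hx) with h | h
    · rw [h0 v x, ENNReal.toReal_zero, zero_mul]
      exact ((ENNReal.toReal_eq_zero_iff _).1 h).resolve_right (PMF.apply_ne_top _ _)
    · rw [h, mul_zero]
  have hle (z : ℝ) (hz : z ∈ coordinateValues 𝒳 i) (h : coordinateProb (p v) i z ≠ 0) :
      coordinateProb (p (flipAt v i)) i z < coordinateProb (p v) i z := by
    obtain ⟨x, hx𝒳, rfl⟩ := Finset.mem_image.1 hz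
    exact (div_lt_one ((coordinateProb_nonneg _ _ _).lt_of_ne' h)).1 (hx ⟨x, hx𝒳⟩)
  have hlt' : ∑ z ∈ coordinateValues 𝒳 i, coordinateProb (p (flipAt v i)) i z <
      ∑ z ∈ coordinateValues 𝒳 i, coordinateProb (p v) i z := by
    obtain ⟨z, hz, hne⟩ : ∃ z ∈ coordinateValues 𝒳 i, coordinateProb (p v) i z ≠ 0 :=
      Finset.exists_ne_zero_of_sum_ne_zero (by simp [sum_coordinateProb])
    refine Finset.sum_lt_sum (fun z hz => ?_) ⟨z, hz, hle z hz hne⟩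
    by_cases h : coordinateProb (p v) i z = 0
    · rw [h, hzero z h]
    · exact (hle z hz h).le
  simp [sum_coordinateProb] at hlt'

/-! ### Assembly. -/

theorem mainTheorem11 {d T : ℕ} (𝒳 : Finset (Fin d → ℝ)) (p : Cube d → PMF 𝒳) (γ : ℝ)
    (hp : OrthonormalDecomposition (fun v => (p v).toMeasure) γ)
    (S : AdaptiveStrategy (obliviousFamily d) T) :
    ∑ i : Fin d, coordinateInformation (fun v => (p v).map Subtype.val) S i ≤
      ENNReal.ofReal (obliviousConstant p / 2 * (T * γ ^ 2)) := by
  rcases isEmpty_or_nonempty (Fin d) with hd | ⟨⟨i₀⟩⟩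
  · simp
  obtain ⟨φ, horth, hflip⟩ := hp.exists_pmf
  have hzero (v : Cube d) (i : Fin d) (x : 𝒳) (h : p v x = 0) : p (flipAt v i) x = 0 := by
    have := hflip v i x
    rw [h, ENNReal.toReal_zero, zero_mul, ENNReal.toReal_eq_zero_iff] at this
    exact this.resolve_right (PMF.apply_ne_top _ _)
  set m : ℝ := ((Finset.univ.sup fun i : Fin d => (coordinateValues 𝒳 i).card : ℕ) : ℝ) - 1
  -- The output `0` does not reveal the sampled index. Keeping the index gives a finite alphabet
  -- with explicit probabilities; `F` forgets it again, and `S'` shows `S` only the forgotten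
  -- outputs.
  set F : (Σ i : Fin d, coordinateValues 𝒳 i) → Fin d → ℝ := fun o => Pi.single o.1 o.2.1
  set S' : AdaptiveStrategy (Set.range (indexedSampling (𝒳 := 𝒳))) T :=
    fun t y => ⟨indexedSampling (S t (F ∘ y)).2.choose, Set.mem_range_self _⟩ with hS'
  set P : Cube d → PMF (Fin T → Σ i : Fin d, coordinateValues 𝒳 i) :=
    fun v => transcriptLaw (p v) T S' with hP
  have hlaw (v : Cube d) :
      transcriptLaw ((p v).map Subtype.val) T S = (P v).map fun y => F ∘ y := by
    refine transcriptLaw_map _ F (p v) S S' fun t y x => ?_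
    rw [← (S t (F ∘ y)).2.choose_spec]
    change obliviousSampling _ x.1 = (indexedSampling _ x).map F
    rw [indexedSampling, PMF.map_comp]
    rfl
  have hI (i : Fin d) : coordinateInformation (fun v => (p v).map Subtype.val) S i ≤
      ENNReal.ofReal (((2 : ℝ) ^ d)⁻¹ / 2 *
        ∑ v, ∑ y, jensenShannon (P v y).toReal (P (flipAt v i) y).toReal) := by
    refine le_of_eq_of_le ?_ (mutualInformation_le P (fun y => F ∘ y) i)
    simp only [coordinateInformation, jointLaw, hlaw, PMF.map_bind, PMF.map_comp]
    rfl
  have hac : ∀ W ∈ Set.range (indexedSampling (𝒳 := 𝒳)), ∀ v i z,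
      (p v).bind W z = 0 → (p (flipAt v i)).bind W z = 0 := by
    intro W _ v i z h
    simp only [PMF.bind_apply, ENNReal.tsum_eq_zero, mul_eq_zero] at h ⊢
    exact fun x => (h x).imp_left (hzero v i x)
  have hM : ∀ W ∈ Set.range (indexedSampling (𝒳 := 𝒳)), ∀ v,
      ∑ i, chiSq ((p (flipAt v i)).bind W) ((p v).bind W) ≤ γ ^ 2 * m := by
    rintro _ ⟨w, rfl⟩ v
    exact sum_chiSq_indexedSampling_le horth hflip w v
  have hm : m ≤ obliviousConstant p := le_obliviousConstant i₀ fun v => hzero v i₀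
  have hm0 : 0 ≤ m := sub_nonneg.2 (one_le_sup_card_coordinateValues (p 1) i₀)
  refine (Finset.sum_le_sum fun i _ => hI i).trans ?_
  rw [← ENNReal.ofReal_sum_of_nonneg fun i _ => mul_nonneg (by positivity)
    (Finset.sum_nonneg fun v _ => Finset.sum_nonneg fun y _ =>
      jensenShannon_nonneg ENNReal.toReal_nonneg ENNReal.toReal_nonneg), ← Finset.mul_sum]
  refine ENNReal.ofReal_le_ofReal ?_
  have h := mul_le_mul_of_nonneg_left (sum_jensenShannon_transcriptLaw_le p hac hM S')
    (show (0 : ℝ) ≤ ((2 : ℝ) ^ d)⁻¹ / 2 by positivity)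
  refine h.trans ?_
  have e : ((2 : ℝ) ^ d)⁻¹ / 2 * (T * (2 ^ d * (γ ^ 2 * m) / 2)) = m / 4 * (T * γ ^ 2) := by
    field_simp
    ring
  rw [e]
  gcongr ?_ * _
  linarith
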